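/- Consider the breakout system in $\mathbb{R}^2$: initially there is a brick on every unit square $[x,x+1]\times[y,y+1]$, $(x,y)\in\mathbb{Z}^2\setminus\{(-1,0)\}$. A ball is launched northeast from $(0,y_0)$, $0<y_0<1$, along a line of slope $S\in(0,1)$. It moves in straight lines at constant speed, and whenever it hits a brick it is reflected by the edge it hits and the brick is destroyed (so brick $[0,1]\times[0,1]$ is destroyed at distance $0$, through a vertical edge). Only orbits that avoid $\mathbb{Z}^2$ are considered. The symbolic orbit is the word $(\omega_n)_{n\ge0}$ with $\omega_n=a$ if the $n$th brick is hit on a horizontal edge and $\omega_n=b$ otherwise. For integers $0\le\rho\le\alpha$ put $|\alpha,\rho|=\frac{\alpha(\alpha+1)}2+\rho+1$ and $X(|\alpha,\rho|)=\sum_{0<n\le\alpha}(-1)^n n+(-1)^{\alpha+1}(\rho+1)$. Let $T_x(n)$ be the abscissa of the ball after it has travelled a horizontal distance $n$. A ternary block is a triple $\Delta=((\alpha_i,\rho_i))_{0\le i\le2}$ of such pairs for which there are $S\in(0,1)$ and $0<y_0<S$ with $i+1<y_0+S|\alpha_i,\rho_i|<i+1+S$ for $i=0,1,2$. It is also written $(\chi_0,\chi_1,\chi_2)$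 with $\chi_0+\dots+\chi_i=|\alpha_i,\rho_i|$. It is elementary if $\alpha_2-2\rho_2=\alpha_0-2\rho_0$ when $\alpha_0,\alpha_2$ have the same parity and $\alpha_2-2\rho_2=-\alpha_0+2\rho_0+1$ otherwise. An orbit of slope $S$ with initial ordinate $y_0\in(0,S)$ has elementary sequence $(\Delta_n)_{n\ge0}$, $\Delta_n=((\alpha_{i,n},\rho_{i,n}))_{0\le i\le2}$, if all $\Delta_n$ are elementary blocks and, for all $N\ge0$ and $0\le i\le2$, $$T_x(\Sigma_N+|\alpha_{i,N},\rho_{i,N}|)=T_x(\Sigma_N)+(-1)^{\alpha_N}X(|\alpha_{i,N},\rho_{i,N}|),\qquad \Sigma_N=\sum_{j<N}|\alpha_{2,j},\rho_{2,j}|,\quad \alpha_N=\sum_{j<N}(\alpha_{2,j}+1).$$ Its slicing sequence is $(\chi_n)_{n\ge0}$ if $y_0+S\sum_{n\le N}\chi_n\in(N+1,N+1+S)$ for all $N\ge0$. Proposition. There are infinitely many words in $\{a,b\}^{\mathbb{N}}$ that are periodic and are the symbolic orbit of a breakout orbit. More precisely, let $\Lambda=(138,138,138)=((16,1),(22,22),(28,7))$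 and $\Lambda_{0+}=(139,138,138)=((16,2),(23,0),(28,8))$. There are words $\omega^{(J)}\in\{a,b\}^{\mathbb{N}}$, $J>1$, such that 1. for every integer $J>1$, $\omega^{(J)}$ is periodic and there is a breakout orbit with slope $S=\frac{3J}{3J\cdot138+1}$ and initial ordinate in $(0,S)$ that has elementary sequence $(\Lambda^{J-1}\Lambda_{0+})^\infty$, whose slicing sequence is the concatenation of the triples $(\chi_0,\chi_1,\chi_2)$ of these blocks, and whose symbolic orbit is $\omega^{(J)}$; 2. the words $\omega^{(J)}$, $J>1$, are pairwise distinct; 3. their minimal periods are arbitrarily large. -/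

import Mathlib

namespace Breakout

/-! ### The breakout system -/

/-- The letters of symbolic words: `a` stands for a horizontal edge, `b` for a vertical edge. -/
inductive Letter
  | a
  | b

/-- The closed unit square whose lower left corner is `c`. -/
def square (c : ℤ × ℤ) : Set (ℝ × ℝ) :=
  Set.Icc (c.1 : ℝ) (c.1 + 1) ×ˢ Set.Icc (c.2 : ℝ) (c.2 + 1)

/-- Reflection of a velocity: a bounce on a horizontal edge reverses the vertical coordinate, a
bounce on a vertical edge reverses the horizontal coordinate. -/
def reflect : Letter → ℝ × ℝ → ℝ × ℝ
  | Letter.a, v => (v.1, -v.2)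
  | Letter.b, v => (-v.1, v.2)

/-- `HitsAt l c p v`: a ball that arrives at the point `p` with velocity `v` hits the square with
lower left corner `c` from outside, at a relatively interior point of one of its edges, which is
horizontal if `l = a` and vertical if `l = b`. -/
def HitsAt : Letter → ℤ × ℤ → ℝ × ℝ → ℝ × ℝ → Prop
  | Letter.a, c, p, v =>
      ((c.1 : ℝ) < p.1 ∧ p.1 < c.1 + 1) ∧
        ((0 < v.2 ∧ p.2 = c.2) ∨ (v.2 < 0 ∧ p.2 = c.2 + 1))
  | Letter.b, c, p, v =>
      ((c.2 : ℝ) < p.2 ∧ p.2 < c.2 + 1) ∧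
        ((0 < v.1 ∧ p.1 = c.1) ∨ (v.1 < 0 ∧ p.1 = c.1 + 1))

/-- The bricks that are still present just before the `n`-th hit, when the bricks broken by the
successive hits are `brick 0, brick 1, …`. Initially there is a brick on every unit square of the
integer grid except the one with lower left corner `(-1, 0)`. -/
def remaining (brick : ℕ → ℤ × ℤ) (n : ℕ) : Set (ℤ × ℤ) :=
  {c | c ≠ (-1, 0) ∧ ∀ k < n, brick k ≠ c}

/-- The breakout orbit of a ball launched northeast from `(0, y)`, with slope `S`. The ball is
parametrised so that its horizontal speed is `1`: time is the horizontal distance travelled. -/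
structure BreakoutOrbit (S y : ℝ) where
  /-- position of the ball; only its values at times `t ≥ 0` are meaningful -/
  path : ℝ → ℝ × ℝ
  /-- time of the `n`-th hit -/
  time : ℕ → ℝ
  /-- velocity with which the ball arrives at the `n`-th hit -/
  vel : ℕ → ℝ × ℝ
  /-- brick broken by the `n`-th hit -/
  brick : ℕ → ℤ × ℤ
  /-- kind of the edge on which the `n`-th hit takes place: the symbolic orbit -/
  word : ℕ → Letter
  slope_mem : S ∈ Set.Ioo (0 : ℝ) 1
  ordinate_mem : y ∈ Set.Ioo (0 : ℝ) 1
  path_zero : path 0 = (0, y)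
  vel_zero : vel 0 = (1, S)
  /-- the ball is launched from the edge of the first broken brick -/
  time_zero : time 0 = 0
  time_strictMono : StrictMono time
  time_tendsto : Filter.Tendsto time Filter.atTop Filter.atTop
  /-- each hit reflects the velocity -/
  vel_succ : ∀ n, vel (n + 1) = reflect (word n) (vel n)
  /-- the ball moves along a straight line between two hits -/
  path_eq : ∀ n, ∀ t ∈ Set.Icc (time n) (time (n + 1)),
    path t = path (time n) + (t - time n) • vel (n + 1)
  /-- the `n`-th hit is on a brick that is still present; this brick is then broken -/
  brick_mem : ∀ n, brick n ∈ remaining brick n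
  hits : ∀ n, HitsAt (word n) (brick n) (path (time n)) (vel n)
  /-- the ball meets no remaining brick between two hits -/
  free : ∀ n, ∀ t ∈ Set.Ioo (time n) (time (n + 1)), ∀ c ∈ remaining brick (n + 1),
    path t ∉ square c
  /-- the orbit does not meet the integer lattice -/
  avoids_lattice : ∀ t, 0 ≤ t → ∀ c : ℤ × ℤ, path t ≠ ((c.1 : ℝ), (c.2 : ℝ))

/-- The infinite words that are symbolic orbits of breakout orbits. -/
def IsSymbolicOrbit (ω : ℕ → Letter) : Prop :=
  ∃ S y : ℝ, ∃ o : BreakoutOrbit S y, o.word = ω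

/-- `p` is a period of the infinite word `ω`. -/
def IsPeriod (ω : ℕ → Letter) (p : ℕ) : Prop :=
  0 < p ∧ ∀ n, ω (n + p) = ω n

/-- Periodicity of an infinite word (from its first letter on). -/
def IsPeriodicWord (ω : ℕ → Letter) : Prop :=
  ∃ p, IsPeriod ω p

/-- The travelling ordinate after a horizontal distance `x`: the ordinate of the ball after
unfolding along horizontal edges. -/
def travelOrdinate (S y x : ℝ) : ℝ := y + S * x

/-- The travelling abscissa: the abscissa of the ball after a horizontal distance `n`. -/
def BreakoutOrbit.travelAbscissa {S y : ℝ} (o : BreakoutOrbit S y) (n : ℕ) : ℝ :=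
  (o.path n).1

/-! ### Blocks -/

/-- The horizontal distance `|α, ρ|`. -/
def dist (α ρ : ℕ) : ℕ := α * (α + 1) / 2 + (ρ + 1)

/-- The abscissa `X(|α, ρ|)`. -/
def absc (α ρ : ℕ) : ℤ :=
  (∑ n ∈ Finset.Icc 1 α, (-1 : ℤ) ^ n * (n : ℤ)) + (-1) ^ (α + 1) * ((ρ : ℤ) + 1)

/-- A triple of pairs `(α i, ρ i)`, `0 ≤ i ≤ 2`. -/
structure Block where
  α : Fin 3 → ℕ
  ρ : Fin 3 → ℕ

namespace Block

/-- The distance `|α i, ρ i|`. -/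
def len (Δ : Block) (i : Fin 3) : ℕ := dist (Δ.α i) (Δ.ρ i)

/-- The abscissa `X(|α i, ρ i|)`. -/
def X (Δ : Block) (i : Fin 3) : ℤ := absc (Δ.α i) (Δ.ρ i)

/-- The expression `(χ₀, χ₁, χ₂)` of a block by elements of a slicing sequence. -/
def slices (Δ : Block) : Fin 3 → ℤ :=
  ![(Δ.len 0 : ℤ), (Δ.len 1 : ℤ) - Δ.len 0, (Δ.len 2 : ℤ) - Δ.len 1]

/-- Ternary blocks: triples of pairs with `0 ≤ ρ i ≤ α i` that admit a primary slope. -/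
def IsTernary (Δ : Block) : Prop :=
  (∀ i, Δ.ρ i < Δ.α i + 1) ∧
    ∃ S ∈ Set.Ioo (0 : ℝ) 1, ∃ y ∈ Set.Ioo (0 : ℝ) S, ∀ i : Fin 3,
      travelOrdinate S y (Δ.len i) ∈ Set.Ioo ((i : ℝ) + 1) ((i : ℝ) + 1 + S)

/-- Elementary blocks: the third horizontal edge that is met belongs to the broken top brick. -/
def IsElementary (Δ : Block) : Prop :=
  Δ.IsTernary ∧
    ((Even (Δ.α 0) ↔ Even (Δ.α 2)) →
      (Δ.α 2 : ℤ) - 2 * Δ.ρ 2 = Δ.α 0 - 2 * Δ.ρ 0) ∧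
    (¬(Even (Δ.α 0) ↔ Even (Δ.α 2)) →
      (Δ.α 2 : ℤ) - 2 * Δ.ρ 2 = -Δ.α 0 + 2 * Δ.ρ 0 + 1)

end Block

/-- The number of reversals of the horizontal direction in the first `N` blocks of a sequence. -/
def reversals (Δ : ℕ → Block) (N : ℕ) : ℕ := ∑ j ∈ Finset.range N, ((Δ j).α 2 + 1)

/-- The horizontal distance travelled along the first `N` blocks of a sequence. -/
def totalLen (Δ : ℕ → Block) (N : ℕ) : ℕ := ∑ j ∈ Finset.range N, (Δ j).len 2

/-- The orbit goes successively through the elementary blocks `Δ 0, Δ 1, …`. A slope `S` is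
elementary with elementary sequence `Δ` if this holds for an orbit of slope `S` with initial
ordinate in `(0, S)`. -/
def BreakoutOrbit.HasElementarySequence {S y : ℝ} (o : BreakoutOrbit S y) (Δ : ℕ → Block) :
    Prop :=
  (∀ n, (Δ n).IsElementary) ∧
    ∀ N, ∀ i : Fin 3,
      o.travelAbscissa (totalLen Δ N + (Δ N).len i) =
        o.travelAbscissa (totalLen Δ N) + (-1) ^ reversals Δ N * ((Δ N).X i : ℝ)

/-- `χ` is the slicing sequence of the slope `S` and the initial ordinate `y`. -/
def IsSlicingSequence (S y : ℝ) (χ : ℕ → ℤ) : Prop :=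
  ∀ N : ℕ, travelOrdinate S y (∑ n ∈ Finset.range (N + 1), (χ n : ℝ)) ∈
    Set.Ioo ((N : ℝ) + 1) ((N : ℝ) + 1 + S)

/-- The sequence of integers obtained by concatenating the triples `(χ₀, χ₁, χ₂)` of the blocks
of a sequence. -/
def concatSlices (Δ : ℕ → Block) (n : ℕ) : ℤ := (Δ (n / 3)).slices (Fin.ofNat 3 n)

/-- The block `Λ = (138, 138, 138)`. -/
def blockL : Block := ⟨![16, 22, 28], ![1, 22, 7]⟩

/-- The block `Λ₀₊ = (139, 138, 138)`. -/
def blockL0 : Block := ⟨![16, 23, 28], ![2, 0, 8]⟩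

theorem blockL_slices : blockL.slices = ![138, 138, 138] := by
  decide

theorem blockL0_slices : blockL0.slices = ![139, 138, 138] := by
  decide

/-- The periodic sequence of blocks `(Λ^(J-1) Λ₀₊)^∞`. -/
def blockSeq (J n : ℕ) : Block := if n % J + 1 = J then blockL0 else blockL

/-- The slope `3J / (3J · 138 + 1)`. -/
noncomputable def slope (J : ℕ) : ℝ := (3 * J : ℝ) / (3 * J * 138 + 1)

end Breakout

namespace Breakout

/-! ### Periodic chains of blocks -/

/-! The motion splits into blocks of 31 hits, 29 on vertical and 2 on horizontal edges, and block
`k` takes place essentially in row `k`. The ball enters the row through a hole one brick wide and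
bounces between two receding walls, so that its `i`-th vertical hit occurs at the triangular
distance `tri i`, whatever the slope. Meanwhile it climbs one unit of travelling ordinate per
distance `138 + 2 * ε`. At the first integer crossing it breaks a brick of the row above, at the
second a brick of the row below. At the third it goes up through the gap that the first one left,
meets the left wall of this gap in local coordinates, and so starts the next block in the mirror
image.

The vertical times are integers, and a crossing matters only through the open unit interval between
integers that contains it. `Itinerary` records inequalities that put the crossing of ordinate `m` in
`(138 * m - 1 + delay, 138 * m + delay)`; delay `0` gives `Λ` and delay `1` gives `Λ₀₊`. Hence the
order of the hits is known exactly (`segment_bounds`). The hits lie on bricks still present because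
`breakIndex` recovers the time of a hit from its brick (`breakIndex_brick`), and no other brick is
met because the swept part of a row is already empty (`free`). This turns any itinerary into a
breakout orbit (`orbit`).

For the given slope the phase gains `1 / J` per block and a delay of `1` every `J` blocks resets it,
so the delays are `J`-periodic. The word marks a delay by the place of its second `a` in the block,
so it is periodic; comparing the places of the letters `a` shows that no period is smaller than `J`.
-/

/-- The parameters of an orbit that runs through blocks of horizontal length `414` or `415`:
`delay k` is the excess of the length of the `k`-th block over `414`, the ball has local ordinate
`S * (1 - phase k)` when it enters that block, and the slope is `S = 1 / (138 + 2 * ε)`. -/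
structure Itinerary where
  S : ℝ
  ε : ℝ
  delay : ℕ → ℕ
  phase : ℕ → ℝ
  ε_pos : 0 < ε
  slope_eq : S * (138 + 2 * ε) = 1
  delay_le : ∀ k, delay k ≤ 1
  phase_pos : ∀ k, 0 < phase k
  phase_lt : ∀ k, phase k < 1
  -- The shift `2 * ε` belongs to the first crossing and `6 * ε` to the third; the lower bound at
  -- the first and the upper bound at the third control the second as well.
  lt_phase : ∀ k, (delay k : ℝ) < phase k + 2 * ε
  phase_add_lt : ∀ k, phase k + 6 * ε < 1 + delay k
  phase_succ : ∀ k, phase (k + 1) = phase k + 6 * ε - delay k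

/-! ### Combinatorics of one block in local coordinates -/

/-- The triangular numbers: the distances at which the ball meets vertical edges. -/
def tri : ℕ → ℕ
  | 0 => 0
  | i + 1 => tri i + (i + 1)

/-- The local abscissa at distance `tri i`. -/
def turn : ℕ → ℤ
  | 0 => 0
  | i + 1 => turn i - (-1) ^ i * (i + 1)

/-- The column of the brick hit at distance `tri i`. -/
def sideCol (i : ℕ) : ℤ := if i % 2 = 0 then (i / 2 : ℕ) else -(i / 2 : ℕ) - 2

theorem turn_two_mul (a : ℕ) : turn (2 * a) = a ∧ turn (2 * a + 1) = -a - 1 := by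
  induction a with
  | zero => simp [turn]
  | succ a ih =>
    have h : turn (2 * (a + 1)) = (a + 1 : ℕ) := by
      rw [show 2 * (a + 1) = (2 * a + 1) + 1 by ring, turn, ih.2, pow_succ, pow_mul]
      push_cast; ring
    refine ⟨h, ?_⟩
    rw [turn, h, pow_mul]
    push_cast; ring

/-- The number of hits on horizontal edges among the hits `0, …, j` of a block. -/
def nA (e j : ℕ) : ℕ := (if 17 ≤ j then 1 else 0) + (if 24 + e ≤ j then 1 else 0)

/-- The index of the last hit on a vertical edge among the hits `0, …, j` of a block. -/
def nB (e j : ℕ) : ℕ := j - nA e j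

/-- The position in its block of the `i`-th hit on a vertical edge. -/
def posB (e i : ℕ) : ℕ := i + (if 17 ≤ i then 1 else 0) + (if 23 + e ≤ i then 1 else 0)

/-- The letter of the `j`-th hit of a block. -/
def letter (e j : ℕ) : Letter := if j = 17 ∨ j = 24 + e then Letter.a else Letter.b

/-- The brick broken by the `j`-th hit of a block, in local coordinates. -/
def localBrick (e j : ℕ) : ℤ × ℤ :=
  if j = 17 then (6 - e, 1) else if j = 24 + e then (-12, -1) else (sideCol (nB e j), 0)

/-- The local abscissa at distance `t` after the `i`-th hit on a vertical edge. -/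
def zig (i : ℕ) (t : ℝ) : ℝ := turn i - (-1) ^ i * (t - tri i)

/-- The local ordinate of a ball with travelling ordinate `Y` after `m` hits on horizontal
edges. -/
def fold (m : ℕ) (Y : ℝ) : ℝ := (-1) ^ m * (Y - m) + (m % 2 : ℕ)

theorem zig_succ (i : ℕ) : zig (i + 1) (tri (i + 1)) = zig i (tri (i + 1)) := by
  simp only [zig, turn, tri]; push_cast; ring

theorem nB_posB {e i : ℕ} (he : e ≤ 1) (hi : i ≤ 28) :
    nB e (posB e i) = i ∧ posB e i ≠ 17 ∧ posB e i ≠ 24 + e ∧ posB e i < 31 := by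
  simp only [nB, posB, nA]; split_ifs <;> omega

theorem posB_nB {e j : ℕ} (he : e ≤ 1) (hj : j < 31) (h17 : j ≠ 17) (h24 : j ≠ 24 + e) :
    posB e (nB e j) = j ∧ nB e j ≤ 28 := by
  simp only [nB, posB, nA]; split_ifs <;> omega

theorem posB_le {e i j : ℕ} (he : e ≤ 1) (hj : j < 31) (h : i ≤ nB e j) : posB e i ≤ j := by
  revert h
  simp only [nB, posB, nA]; split_ifs <;> omega

theorem nB_le {e j : ℕ} (he : e ≤ 1) (hj : j < 31) : nB e j ≤ 28 := by
  simp only [nB, nA]; split_ifs <;> omega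

/-! ### Timing of crossings and hits -/

namespace Itinerary

variable (I : Itinerary)

theorem S_pos : 0 < I.S := by
  have h1 := I.slope_eq
  have h2 := I.ε_pos
  by_contra h
  nlinarith

theorem S_lt_one : I.S < 1 := by
  have h1 := I.slope_eq
  have h2 := I.ε_pos
  have h3 := I.S_pos
  nlinarith

/-- The distance at which block `k` starts. -/
def start (k : ℕ) : ℕ := ∑ j ∈ Finset.range k, (414 + I.delay j)

/-- The abscissa at which block `k` starts. -/
def center (k : ℕ) : ℤ := ∑ j ∈ Finset.range k, (-1) ^ j * (6 - I.delay j : ℤ)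

theorem start_succ (k : ℕ) : I.start (k + 1) = I.start k + (414 + I.delay k) :=
  Finset.sum_range_succ _ _

theorem center_succ (k : ℕ) :
    I.center (k + 1) = I.center k + (-1) ^ k * (6 - I.delay k : ℤ) :=
  Finset.sum_range_succ _ _

/-- The local time at which the travelling ordinate of block `k` is `m`. -/
def cross (k m : ℕ) : ℝ := 138 * m - 1 + I.phase k + 2 * m * I.ε

/-- The travelling ordinate of block `k` at local time `t`. -/
def lift (k : ℕ) (t : ℝ) : ℝ := I.S * (t + 1 - I.phase k)

/-- The local time of the `j`-th hit of block `k`. -/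
def hitTime (k j : ℕ) : ℝ :=
  if j = 17 then I.cross k 1 else if j = 24 + I.delay k then I.cross k 2
  else tri (nB (I.delay k) j)

/-- The local time of the hit that follows the `j`-th hit of block `k`. -/
def nextTime (k j : ℕ) : ℝ := if j < 30 then I.hitTime k (j + 1) else 414 + I.delay k

theorem lift_sub (k m : ℕ) (t : ℝ) : I.lift k t - m = I.S * (t - I.cross k m) := by
  have := I.slope_eq
  simp only [lift, cross]
  linear_combination (m : ℝ) * this

theorem lift_cross (k m : ℕ) : I.lift k (I.cross k m) = m := by
  have := I.lift_sub k m (I.cross k m)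
  simp only [sub_self, mul_zero] at this
  linarith

theorem lt_lift {k m : ℕ} {t : ℝ} (h : I.cross k m < t) : (m : ℝ) < I.lift k t := by
  have := I.lift_sub k m t
  have := mul_pos I.S_pos (sub_pos.2 h)
  linarith

theorem lift_lt {k m : ℕ} {t : ℝ} (h : t < I.cross k m) : I.lift k t < m := by
  have := I.lift_sub k m t
  have := mul_pos I.S_pos (sub_pos.2 h)
  have : I.S * (t - I.cross k m) = - (I.S * (I.cross k m - t)) := by ring
  linarith

/-- Bounds for the crossings of block `k`. -/
theorem cross_mem (k m : ℕ) (h1 : 1 ≤ m) (h3 : m ≤ 3) :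
    138 * m - 1 + (I.delay k : ℝ) < I.cross k m ∧ I.cross k m < 138 * m + (I.delay k : ℝ) := by
  have h := I.ε_pos
  have h1' := I.lt_phase k
  have h2' := I.phase_add_lt k
  have h3' : (1 : ℝ) ≤ m := by exact_mod_cast h1
  have h4' : (m : ℝ) ≤ 3 := by exact_mod_cast h3
  constructor <;> simp only [cross] <;> nlinarith

theorem delay_cases (k : ℕ) : I.delay k = 0 ∨ I.delay k = 1 := by
  have := I.delay_le k; omega

/-- The `j`-th segment of block `k` takes place in one run between vertical edges, and, but for
the last one, in one run between horizontal edges. -/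
theorem segment_bounds (k j : ℕ) (hj : j < 31) :
    I.hitTime k j < I.nextTime k j ∧
    (tri (nB (I.delay k) j) : ℝ) ≤ I.hitTime k j ∧
    I.nextTime k j ≤ tri (nB (I.delay k) j + 1) ∧
    I.cross k (nA (I.delay k) j) ≤ I.hitTime k j ∧
    (j < 30 → I.nextTime k j ≤ I.cross k (nA (I.delay k) j + 1)) ∧
    I.hitTime k j < I.cross k (nA (I.delay k) j + 1) := by
  have c1 := I.cross_mem k 1 (by norm_num) (by norm_num)
  have c2 := I.cross_mem k 2 (by norm_num) (by norm_num)
  have c3 := I.cross_mem k 3 (by norm_num) (by norm_num)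
  have c0 : I.cross k 0 < 0 := by
    have := I.phase_lt k
    simp only [cross]; norm_num; linarith
  simp only [nextTime, hitTime]
  -- Once the delay and `j` are fixed, only numerals and the unit intervals around the crossings
  -- remain to be compared.
  rcases I.delay_cases k with h | h <;> rw [h] at c1 c2 c3 ⊢ <;> norm_num at c1 c2 c3 <;>
    interval_cases j <;> norm_num [nA, nB, tri] <;>
    (repeat' apply And.intro) <;> linarith

end Itinerary
end Breakout
namespace Breakout

/-! ### The orbit of an itinerary -/

namespace Itinerary

variable (I : Itinerary)

/-- The column with local abscissa `c` in block `k`. -/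
def col (k : ℕ) (c : ℤ) : ℤ := if k % 2 = 0 then I.center k + c else I.center k - 1 - c

/-- The local abscissa in block `k` of a column. -/
def localCol (k : ℕ) (C : ℤ) : ℤ := if k % 2 = 0 then C - I.center k else I.center k - 1 - C

/-- The point with local coordinates `q` in block `k`. -/
def embed (k : ℕ) (q : ℝ × ℝ) : ℝ × ℝ := (I.center k + (-1) ^ k * q.1, k + q.2)

/-- The time of the `n`-th hit. -/
def time (n : ℕ) : ℝ := I.start (n / 31) + I.hitTime (n / 31) (n % 31)

/-- The symbolic orbit. -/
def word (n : ℕ) : Letter := letter (I.delay (n / 31)) (n % 31)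

/-- The brick broken by the `n`-th hit. -/
def brick (n : ℕ) : ℤ × ℤ :=
  (I.col (n / 31) (localBrick (I.delay (n / 31)) (n % 31)).1,
    (n / 31 : ℕ) + (localBrick (I.delay (n / 31)) (n % 31)).2)

/-- The velocity after the `j`-th hit of block `k`. -/
def velOut (k j : ℕ) : ℝ × ℝ :=
  ((-1) ^ k * (-1) ^ (nB (I.delay k) j + 1), I.S * (-1) ^ nA (I.delay k) j)

/-- The velocity before the `n`-th hit. -/
def vel (n : ℕ) : ℝ × ℝ := reflect (I.word n) (I.velOut (n / 31) (n % 31))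

/-- The position at time `t` of a ball that moves freely after the `j`-th hit of block `k`. -/
def seg (k j : ℕ) (t : ℝ) : ℝ × ℝ :=
  I.embed k (zig (nB (I.delay k) j) (t - I.start k),
    fold (nA (I.delay k) j) (I.lift k (t - I.start k)))

end Itinerary

theorem add_div_31 {k j : ℕ} (hj : j < 31) : (31 * k + j) / 31 = k := by omega

theorem add_mod_31 {k j : ℕ} (hj : j < 31) : (31 * k + j) % 31 = j := by omega

theorem exists_block (n : ℕ) : ∃ k j, j < 31 ∧ n = 31 * k + j :=
  ⟨n / 31, n % 31, by omega, by omega⟩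

theorem reflect_reflect (l : Letter) (v : ℝ × ℝ) : reflect l (reflect l v) = v := by
  cases l <;> simp [reflect]

/-- The counts of hits, from one hit of a block to the next one. -/
theorem counts_succ {e j : ℕ} (he : e ≤ 1) (hj : j < 30) :
    (letter e (j + 1) = Letter.b ∧ j + 1 ≠ 17 ∧ j + 1 ≠ 24 + e ∧ nA e (j + 1) = nA e j ∧
      nB e (j + 1) = nB e j + 1) ∨
    (letter e (j + 1) = Letter.a ∧ (j + 1 = 17 ∧ nA e j = 0 ∨ j + 1 = 24 + e ∧ nA e j = 1) ∧
      nA e (j + 1) = nA e j + 1 ∧ nB e (j + 1) = nB e j) := by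
  by_cases h17 : j + 1 = 17
  · right
    obtain rfl : j = 16 := by omega
    refine ⟨by simp [letter], Or.inl ⟨rfl, ?_⟩, ?_, ?_⟩ <;>
      simp only [nB, nA] <;> split_ifs <;> omega
  by_cases h24 : j + 1 = 24 + e
  · right
    refine ⟨by simp [letter, h24], Or.inr ⟨h24, ?_⟩, ?_, ?_⟩ <;>
      simp only [nB, nA] <;> split_ifs <;> omega
  · left
    refine ⟨by simp [letter, h17, h24], h17, h24, ?_, ?_⟩ <;>
      simp only [nB, nA] <;> split_ifs <;> omega

/-- Right walls `0, 1, 2, …` have even index and left walls `-2, -3, …` odd index, so a column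
determines its index. The 29 vertical hits of a block stay within `-15, …, 14`, and `-1` is the
entrance hole. -/
theorem sideCol_index (i : ℕ) :
    (if 0 ≤ sideCol i then 2 * sideCol i else -2 * sideCol i - 3).toNat = i ∧ sideCol i ≠ -1 ∧
      (i ≤ 28 → -15 ≤ sideCol i ∧ sideCol i ≤ 14) := by
  rw [sideCol]
  rcases Nat.mod_two_eq_zero_or_one i with h | h
  · rw [if_pos h]; refine ⟨?_, ?_, fun _ => ?_⟩
    · split_ifs <;> omega
    · omega
    · omega
  · rw [if_neg (by omega)]; refine ⟨?_, ?_, fun _ => ?_⟩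
    · split_ifs <;> omega
    · omega
    · omega

/-- By `sideCol_index` the conclusion says that `c` is the entrance hole or a column broken by one
of the vertical hits `0, …, i`. Strictness of the time bounds keeps the ball off the next wall. -/
theorem zig_bounds {i : ℕ} {t : ℝ} (h1 : (tri i : ℝ) < t) (h2 : t < tri (i + 1)) {c : ℤ}
    (hc1 : (c : ℝ) ≤ zig i t) (hc2 : zig i t ≤ c + 1) :
    2 * c ≤ i ∧ -2 * c - 3 ≤ i := by
  have h3 : (tri (i + 1) : ℝ) = tri i + (i + 1) := by simp only [tri]; push_cast; ring
  rcases Nat.even_or_odd' i with ⟨a, rfl | rfl⟩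
  · rw [zig, (turn_two_mul a).1, pow_mul] at hc1 hc2
    push_cast at hc1 hc2 h3
    norm_num at hc1 hc2
    have e1 : (c : ℝ) < a := by linarith
    have e2 : (-a - 2 : ℝ) < c := by linarith
    have e1' : c < a := by exact_mod_cast e1
    have e2' : (-a - 2 : ℤ) < c := by exact_mod_cast e2
    push_cast; omega
  · rw [zig, (turn_two_mul a).2, pow_succ, pow_mul] at hc1 hc2
    push_cast at hc1 hc2 h3
    norm_num at hc1 hc2
    have e1 : (c : ℝ) < a + 1 := by linarith
    have e2 : (-a - 2 : ℝ) < c := by linarith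
    have e1' : c < a + 1 := by exact_mod_cast e1
    have e2' : (-a - 2 : ℤ) < c := by exact_mod_cast e2
    push_cast; omega

theorem fold_mem {m : ℕ} (hm : m ≤ 2) {Y : ℝ} (h1 : (m : ℝ) < Y) (h2 : Y < m + 1) :
    0 < fold m Y ∧ fold m Y < 1 := by
  interval_cases m <;> norm_num [fold] at * <;> constructor <;> linarith

theorem nA_le (e j : ℕ) : nA e j ≤ 2 := by
  simp only [nA]; split_ifs <;> omega

/-! ### Continuity of position and velocity from hit to hit -/

namespace Itinerary

variable (I : Itinerary)

theorem time_block {k j : ℕ} (hj : j < 31) : I.time (31 * k + j) = I.start k + I.hitTime k j := by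
  rw [time, add_div_31 hj, add_mod_31 hj]

theorem word_block {k j : ℕ} (hj : j < 31) : I.word (31 * k + j) = letter (I.delay k) j := by
  rw [word, add_div_31 hj, add_mod_31 hj]

theorem vel_block {k j : ℕ} (hj : j < 31) :
    I.vel (31 * k + j) = reflect (letter (I.delay k) j) (I.velOut k j) := by
  rw [vel, word_block I hj, add_div_31 hj, add_mod_31 hj]

theorem brick_block {k j : ℕ} (hj : j < 31) :
    I.brick (31 * k + j) = (I.col k (localBrick (I.delay k) j).1,
      (k : ℤ) + (localBrick (I.delay k) j).2) := by
  rw [brick, add_div_31 hj, add_mod_31 hj]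

theorem hitTime_zero (k : ℕ) : I.hitTime k 0 = 0 := by
  have h : 0 ≠ 24 + I.delay k := by omega
  simp [hitTime, nB, tri, h]

theorem time_next {k j : ℕ} (hj : j < 31) :
    I.time (31 * k + j + 1) = I.start k + I.nextTime k j := by
  by_cases h : j < 30
  · rw [add_assoc, I.time_block (by omega), nextTime, if_pos h]
  · obtain rfl : j = 30 := by omega
    rw [show 31 * k + 30 + 1 = 31 * (k + 1) + 0 by ring, I.time_block (by omega), start_succ,
      hitTime_zero, nextTime, if_neg h]
    push_cast; ring

theorem time_lt_succ (n : ℕ) : I.time n < I.time (n + 1) := by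
  obtain ⟨k, j, hj, rfl⟩ := exists_block n
  rw [I.time_block hj, I.time_next hj]
  linarith [(I.segment_bounds k j hj).1]

theorem time_strictMono : StrictMono I.time := strictMono_nat_of_lt_succ I.time_lt_succ

theorem time_zero : I.time 0 = 0 := by
  have := I.time_block (k := 0) (j := 0) (by norm_num)
  simpa [hitTime_zero, start] using this

theorem le_start (k : ℕ) : k ≤ I.start k := by
  induction k with
  | zero => simp
  | succ k ih => rw [start_succ]; omega

theorem time_tendsto : Filter.Tendsto I.time Filter.atTop Filter.atTop := by
  refine Filter.tendsto_atTop_atTop_of_monotone I.time_strictMono.monotone fun b => ?_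
  obtain ⟨k, hk⟩ := exists_nat_ge b
  refine ⟨31 * k + 0, ?_⟩
  rw [I.time_block (by norm_num), hitTime_zero, add_zero]
  exact hk.trans (by exact_mod_cast I.le_start k)

/-- The recursion `phase_succ` is chosen to make this true: three units of ordinate cost `414 + 6 *
ε`, and the rest of the block is the initial ordinate of the next one. -/
theorem lift_end (k : ℕ) : I.lift k (414 + I.delay k) = 3 + I.lift (k + 1) 0 := by
  have := I.slope_eq
  simp only [lift, I.phase_succ]
  linear_combination 3 * this

/-- At the end of a block the local abscissa is `14 - (8 + delay) = 6 - delay`, the increment of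
`center`. Two reflections have undone two of the three units climbed, which leaves one row. -/
theorem seg_end (k : ℕ) :
    I.seg k 30 (I.start k + I.nextTime k 30) =
      I.seg (k + 1) 0 (I.start k + I.nextTime k 30) := by
  have h1 : nA (I.delay k) 30 = 2 := by
    have := I.delay_le k
    simp only [nA]; split_ifs <;> omega
  have h2 : nB (I.delay k) 30 = 2 * 14 := by rw [nB, h1]
  have h3 : nA (I.delay (k + 1)) 0 = 0 := by simp [nA]
  have h4 : nB (I.delay (k + 1)) 0 = 0 := by simp [nB]
  have h5 := I.lift_end k
  have h6 : (I.start k : ℝ) + (414 + I.delay k) - I.start (k + 1) = 0 := by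
    rw [start_succ]; push_cast; ring
  rw [seg, seg, h1, h2, h3, h4, nextTime, if_neg (by norm_num), add_sub_cancel_left, h6, h5,
    embed, embed, center_succ, zig, zig, (turn_two_mul 14).1]
  ext
  · norm_num [tri, turn, pow_succ]; ring
  · norm_num [fold]; ring

theorem seg_step (k j : ℕ) (hj : j < 30) (t : ℝ) (ht : t = I.start k + I.nextTime k j) :
    I.seg k j t = I.seg k (j + 1) t := by
  subst ht
  rw [seg, seg, add_sub_cancel_left, nextTime, if_pos hj, hitTime]
  rcases counts_succ (I.delay_le k) hj with ⟨-, h17, h24, hA, hB⟩ | ⟨-, h | h, hA, hB⟩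
  · rw [if_neg h17, if_neg h24, hA, hB, zig_succ]
  · rw [if_pos h.1, hA, hB, h.2, lift_cross]; norm_num [fold]
  · rw [if_neg (by omega), if_pos h.1, hA, hB, h.2, lift_cross]; norm_num [fold]

/-- Since `vel` is the outgoing velocity reflected back, the reflection law only needs that each
outgoing velocity is the next incoming one. Across blocks the signs match because the number of
vertical hits is odd. -/
theorem vel_succ_block {k j : ℕ} (hj : j < 31) : I.vel (31 * k + j + 1) = I.velOut k j := by
  by_cases h : j < 30
  · rw [add_assoc, I.vel_block (by omega), velOut, velOut]
    rcases counts_succ (I.delay_le k) h with ⟨hl, -, -, hA, hB⟩ | ⟨hl, -, hA, hB⟩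
    · rw [hl, hA, hB, reflect]; simp [pow_succ]
    · rw [hl, hA, hB, reflect]; simp [pow_succ]
  · obtain rfl : j = 30 := by omega
    have h1 : nA (I.delay k) 30 = 2 := by
      have := I.delay_le k
      simp only [nA]; split_ifs <;> omega
    rw [show 31 * k + 30 + 1 = 31 * (k + 1) + 0 by ring, I.vel_block (by omega), velOut, velOut,
      nB, nB, h1]
    have h2 : 0 ≠ 24 + I.delay (k + 1) := by omega
    simp [letter, nA, reflect, pow_succ, h2]

theorem vel_succ (n : ℕ) : I.vel (n + 1) = reflect (I.word n) (I.vel n) := by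
  obtain ⟨k, j, hj, rfl⟩ := exists_block n
  rw [I.vel_succ_block hj, I.vel_block hj, I.word_block hj, reflect_reflect]

theorem vel_zero : I.vel 0 = (1, I.S) := by
  have := I.vel_block (k := 0) (j := 0) (by norm_num)
  have h : 0 ≠ 24 + I.delay 0 := by omega
  simpa [letter, velOut, nB, nA, reflect, h] using this

/-- Segments are travelled at constant velocity. -/
theorem seg_eq (k j : ℕ) (s t : ℝ) : I.seg k j t = I.seg k j s + (t - s) • I.velOut k j := by
  simp only [seg, embed, zig, fold, lift, velOut]
  ext
  · simp [pow_succ]; ring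
  · simp; ring

/-! #### Bricks -/

theorem col_localCol (k : ℕ) (C : ℤ) : I.col k (I.localCol k C) = C := by
  simp only [col, localCol]; split_ifs <;> ring

theorem localCol_col (k : ℕ) (c : ℤ) : I.localCol k (I.col k c) = c := by
  simp only [col, localCol]; split_ifs <;> ring

/-- Consecutive blocks use mirrored local coordinates; this change of coordinates identifies bricks
seen from two neighbouring rows. -/
theorem col_succ (k : ℕ) (c : ℤ) : I.col k c = I.col (k + 1) (5 - I.delay k - c) := by
  simp only [col, center_succ]
  rcases Nat.even_or_odd k with h | h
  · have h1 := Nat.even_iff.1 h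
    rw [if_pos h1, if_neg (by omega), h.neg_one_pow]; ring
  · have h1 := Nat.odd_iff.1 h
    rw [if_neg (by omega), if_pos (by omega), h.neg_one_pow]; ring

/-- The index of the hit that breaks a brick which is broken by the orbit. -/
def breakIndex (C : ℤ × ℤ) : ℤ :=
  if C.2 < 0 then 24 + I.delay 0
  else
    let k := C.2.toNat
    let c := I.localCol k C.1
    -- This is `31 * (k - 1) + 17`, the top hit of the preceding block. For `k = 0` it is negative,
    -- which later shows that the initial hole is never hit.
    if c = -1 then 31 * k - 14
    else if -15 ≤ c ∧ c ≤ 14 then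
      31 * k + posB (I.delay k) (if 0 ≤ c then 2 * c else -2 * c - 3).toNat
    -- Outside the swept columns, a brick of row `k` can only be broken from above, as the bottom
    -- brick of block `k + 1`.
    else 31 * (k + 1) + 24 + I.delay (k + 1)

theorem breakIndex_col (k : ℕ) (c : ℤ) :
    I.breakIndex (I.col k c, k) = if c = -1 then 31 * (k : ℤ) - 14
    else if -15 ≤ c ∧ c ≤ 14 then
      31 * (k : ℤ) + posB (I.delay k) (if 0 ≤ c then 2 * c else -2 * c - 3).toNat
    else 31 * ((k : ℤ) + 1) + 24 + I.delay (k + 1) := by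
  simp [breakIndex, localCol_col]

/-- A left inverse makes `brick` injective, so no brick is hit twice. -/
theorem breakIndex_brick (n : ℕ) : I.breakIndex (I.brick n) = n := by
  obtain ⟨k, j, hj, rfl⟩ := exists_block n
  have he := I.delay_le k
  rw [I.brick_block hj, localBrick]
  split_ifs with h17 h24
  · rw [col_succ]
    have := I.breakIndex_col (k + 1) (5 - I.delay k - (6 - I.delay k))
    push_cast at this
    rw [this, if_pos (by ring), h17]; push_cast; ring
  · rcases k with _ | k
    · simp [breakIndex, h24]
    · have he' := I.delay_le k
      -- Seen from the row below, the bottom brick has local column `17 - delay`, which is beyond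
      -- the swept columns `-15, …, 14`.
      have h := I.breakIndex_col k (17 - I.delay k)
      rw [col_succ, show (5 : ℤ) - I.delay k - (17 - I.delay k) = -12 by ring] at h
      simp only [Nat.cast_add, Nat.cast_one, add_neg_cancel_right]
      rw [h, if_neg (by omega), if_neg (by omega), h24]
      push_cast; ring
  · obtain ⟨h1, h2⟩ := posB_nB he hj h17 h24
    simp only [add_zero]
    obtain ⟨h3, h4, h5⟩ := sideCol_index (nB (I.delay k) j)
    rw [breakIndex_col, if_neg h4, if_pos (h5 h2), h3, h1]
    push_cast; ring

theorem brick_mem (n : ℕ) : I.brick n ∈ remaining I.brick n := by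
  refine ⟨fun h => ?_, fun m hm h => ?_⟩
  · have h1 := I.breakIndex_brick n
    have h2 := I.breakIndex_col 0 (-1)
    rw [show I.col 0 (-1) = -1 by simp [col, center]] at h2
    rw [h] at h1
    norm_num at h2
    omega
  · have h1 := I.breakIndex_brick n
    rw [← h, breakIndex_brick] at h1
    omega

/-- The hole from which the ball enters block `k` is empty. -/
theorem hole_not_remaining (k j : ℕ) :
    (I.col k (-1), (k : ℤ)) ∉ remaining I.brick (31 * k + j + 1) := by
  rintro ⟨h1, h2⟩
  rcases k with _ | k
  · exact h1 (by simp [col, center])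
  · refine h2 (31 * k + 17) (by omega) ?_
    rw [I.brick_block (by norm_num), localBrick, if_pos rfl]
    simp only [Nat.cast_add, Nat.cast_one, Prod.mk.injEq, and_true]
    rw [col_succ]; congr 1; ring

/-- The columns between the walls are empty. -/
theorem side_not_remaining {k j : ℕ} (hj : j < 31) {c : ℤ} (h1 : 2 * c ≤ nB (I.delay k) j)
    (h2 : -2 * c - 3 ≤ nB (I.delay k) j) :
    (I.col k c, (k : ℤ)) ∉ remaining I.brick (31 * k + j + 1) := by
  by_cases hc : c = -1
  · rw [hc]; exact I.hole_not_remaining k j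
  rintro ⟨-, h⟩
  have he := I.delay_le k
  obtain ⟨i, hi, hi'⟩ : ∃ i ≤ nB (I.delay k) j, sideCol i = c := by
    rcases le_or_gt 0 c with h0 | h0
    · refine ⟨(2 * c).toNat, by omega, ?_⟩
      rw [sideCol]; split_ifs <;> omega
    · refine ⟨(-2 * c - 3).toNat, by omega, ?_⟩
      rw [sideCol]; split_ifs <;> omega
  have h28 := nB_le he hj
  obtain ⟨p1, p2, p3, p4⟩ := nB_posB he (hi.trans h28)
  have p5 := posB_le he hj hi
  refine h (31 * k + posB (I.delay k) i) (by omega) ?_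
  rw [I.brick_block p4, localBrick, if_neg p2, if_neg p3, p1, hi', add_zero]

/-- Local coordinates of the squares that contain a point. -/
theorem embed_mem_square {k : ℕ} {q : ℝ × ℝ} {C : ℤ × ℤ} (h : I.embed k q ∈ square C) :
    ∃ c r : ℤ, C = (I.col k c, k + r) ∧ (c ≤ q.1 ∧ q.1 ≤ c + 1) ∧ (r ≤ q.2 ∧ q.2 ≤ r + 1) := by
  obtain ⟨⟨h1, h2⟩, h3, h4⟩ := h
  refine ⟨I.localCol k C.1, C.2 - k, by rw [col_localCol]; simp, ?_, ?_⟩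
  · simp only [embed] at h1 h2
    rcases Nat.even_or_odd k with h | h
    · rw [localCol, if_pos (Nat.even_iff.1 h)]
      rw [h.neg_one_pow] at h1 h2
      push_cast; constructor <;> linarith
    · rw [localCol, if_neg (by have := Nat.odd_iff.1 h; omega)]
      rw [h.neg_one_pow] at h1 h2
      push_cast; constructor <;> linarith
  · simp only [embed] at h3 h4
    push_cast; constructor <;> linarith

theorem embed_mem_col (k : ℕ) {q : ℝ × ℝ} {c : ℤ} (h1 : c < q.1) (h2 : q.1 < c + 1) :
    (I.col k c : ℝ) < (I.embed k q).1 ∧ (I.embed k q).1 < I.col k c + 1 := by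
  simp only [embed, col]
  rcases Nat.even_or_odd k with h | h
  · rw [if_pos (Nat.even_iff.1 h), h.neg_one_pow]
    push_cast; constructor <;> linarith
  · rw [if_neg (by have := Nat.odd_iff.1 h; omega), h.neg_one_pow]
    push_cast; constructor <;> linarith

/-! #### The hits -/

theorem zig_top (k : ℕ) {t : ℝ} (h1 : 137 + (I.delay k : ℝ) < t) (h2 : t < 138 + I.delay k) :
    6 - (I.delay k : ℝ) < zig 16 t ∧ zig 16 t < 6 - I.delay k + 1 := by
  rw [zig, (turn_two_mul 8).1]
  norm_num [tri]
  constructor <;> linarith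

theorem zig_bottom (k : ℕ) {t : ℝ} (h1 : 275 + (I.delay k : ℝ) < t) (h2 : t < 276 + I.delay k) :
    -12 < zig (22 + I.delay k) t ∧ zig (22 + I.delay k) t < -12 + 1 := by
  rcases I.delay_cases k with h | h <;> rw [h] at h1 h2 ⊢
  · rw [zig, (turn_two_mul 11).1]
    norm_num [tri] at *
    constructor <;> linarith
  · rw [zig, (turn_two_mul 11).2]
    norm_num [tri] at *
    constructor <;> linarith

/-- On a horizontal hit the unit interval containing the crossing fixes the column of the brick; on
a vertical hit the ordinate is strictly inside the row because crossings never occur at integer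
times. -/
theorem hits (k j : ℕ) (hj : j < 31) :
    HitsAt (I.word (31 * k + j)) (I.brick (31 * k + j)) (I.seg k j (I.start k + I.hitTime k j))
      (I.vel (31 * k + j)) := by
  have hS := I.S_pos
  have he := I.delay_le k
  rw [I.word_block hj, I.brick_block hj, I.vel_block hj, seg, add_sub_cancel_left]
  by_cases h17 : j = 17
  · subst h17
    have hA : nA (I.delay k) 17 = 1 := by simp only [nA]; split_ifs <;> omega
    have hc := I.cross_mem k 1 (by norm_num) (by norm_num)
    norm_num at hc
    obtain ⟨z1, z2⟩ := I.zig_top k hc.1 hc.2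
    rw [letter, if_pos (Or.inl rfl), localBrick, if_pos rfl, hitTime, if_pos rfl, velOut, nB, hA,
      lift_cross]
    refine ⟨I.embed_mem_col k (by push_cast; exact z1) (by push_cast; exact z2), Or.inl ⟨?_, ?_⟩⟩
    · simpa [reflect] using hS
    · simp [embed, fold]
  by_cases h24 : j = 24 + I.delay k
  · have hA : nA (I.delay k) j = 2 := by simp only [nA]; split_ifs <;> omega
    have hB : nB (I.delay k) j = 22 + I.delay k := by rw [nB, hA]; omega
    have hc := I.cross_mem k 2 (by norm_num) (by norm_num)
    norm_num at hc
    obtain ⟨z1, z2⟩ := I.zig_bottom k hc.1 hc.2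
    rw [letter, if_pos (Or.inr h24), localBrick, if_neg h17, if_pos h24, hitTime, if_neg h17,
      if_pos h24, velOut, hB, hA, lift_cross]
    refine ⟨I.embed_mem_col k (by push_cast; exact z1) (by push_cast; exact z2), Or.inr ⟨?_, ?_⟩⟩
    · simpa [reflect] using hS
    · simp [embed, fold]
  · obtain ⟨-, -, -, b1, -, b2⟩ := I.segment_bounds k j hj
    rw [letter, if_neg (by tauto), localBrick, if_neg h17, if_neg h24]
    have ht : I.hitTime k j = tri (nB (I.delay k) j) := by rw [hitTime, if_neg h17, if_neg h24]
    have b1' : I.cross k (nA (I.delay k) j) < I.hitTime k j := by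
      refine lt_of_le_of_ne b1 fun h => ?_
      rw [ht] at h
      rcases Nat.eq_zero_or_pos (nA (I.delay k) j) with h0 | h0
      · rw [h0] at h
        have h1 := I.phase_lt k
        have h2 : (0 : ℝ) ≤ tri (nB (I.delay k) j) := Nat.cast_nonneg _
        rw [← h] at h2
        simp only [cross] at h2
        norm_num at h2
        linarith
      · have hc := I.cross_mem k (nA (I.delay k) j) h0 ((nA_le _ _).trans (by norm_num))
        rw [h] at hc
        -- An integer `tri` cannot lie strictly between two consecutive integers.
        have c1 : 138 * (nA (I.delay k) j) + I.delay k < tri (nB (I.delay k) j) + 1 := by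
          have : (138 * (nA (I.delay k) j) + I.delay k : ℝ) < tri (nB (I.delay k) j) + 1 := by
            linarith
          exact_mod_cast this
        have c2 : tri (nB (I.delay k) j) < 138 * (nA (I.delay k) j) + I.delay k := by
          exact_mod_cast hc.2
        omega
    have y1 := I.lt_lift b1'
    have y2 := I.lift_lt b2
    push_cast at y2
    obtain ⟨f1, f2⟩ := fold_mem (nA_le _ _) y1 y2
    rw [ht] at f1 f2 ⊢
    refine ⟨?_, ?_⟩
    · simp only [embed]
      push_cast; constructor <;> linarith
    · simp only [embed, velOut, reflect, zig, sub_self, mul_zero, sub_zero, col]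
      rcases Nat.even_or_odd' (nB (I.delay k) j) with ⟨a, ha | ha⟩
      · rw [ha, (turn_two_mul a).1]
        have hs : sideCol (2 * a) = a := by
          rw [sideCol, if_pos (by omega)]; congr 1; omega
        rw [hs, pow_succ, pow_mul]
        rcases Nat.even_or_odd k with h | h
        · left; rw [if_pos (Nat.even_iff.1 h), h.neg_one_pow]; norm_num
        · right; rw [if_neg (by have := Nat.odd_iff.1 h; omega), h.neg_one_pow]
          push_cast; constructor <;> norm_num
          ring
      · rw [ha, (turn_two_mul a).2]
        have hs : sideCol (2 * a + 1) = -a - 2 := by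
          rw [sideCol, if_neg (by omega)]; congr 2; omega
        rw [hs, pow_succ, pow_succ, pow_mul]
        rcases Nat.even_or_odd k with h | h
        · right; rw [if_pos (Nat.even_iff.1 h), h.neg_one_pow]
          push_cast; constructor <;> norm_num
          ring
        · left; rw [if_neg (by have := Nat.odd_iff.1 h; omega), h.neg_one_pow]
          push_cast; constructor <;> norm_num
          ring

/-- Inside row `k` the ball only meets columns already emptied. It leaves the row only after the
third crossing, and then stays strictly inside the column of the brick broken by hit `17`. -/
theorem free (k j : ℕ) (hj : j < 31) {t : ℝ} (h1 : I.hitTime k j < t) (h2 : t < I.nextTime k j)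
    (C : ℤ × ℤ) (hC : C ∈ remaining I.brick (31 * k + j + 1)) :
    I.seg k j (I.start k + t) ∉ square C := by
  intro h
  have he := I.delay_le k
  rw [seg, add_sub_cancel_left] at h
  obtain ⟨c, r, rfl, ⟨x1, x2⟩, y1, y2⟩ := I.embed_mem_square h
  obtain ⟨-, b1, b2, b3, b4, -⟩ := I.segment_bounds k j hj
  dsimp only at x1 x2 y1 y2
  obtain ⟨c1, c2⟩ := zig_bounds (b1.trans_lt h1) (h2.trans_le b2) x1 x2
  have row0 : r ≠ 0 := by
    rintro rfl
    rw [add_zero] at hC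
    exact I.side_not_remaining hj c1 c2 hC
  have l1 := I.lt_lift (b3.trans_lt h1)
  rcases lt_or_ge (I.lift k t) (nA (I.delay k) j + 1) with hY | hY
  · obtain ⟨f1, f2⟩ := fold_mem (nA_le _ _) l1 hY
    have r1 : (r : ℝ) < 1 := by linarith
    have r2 : (-1 : ℝ) < r := by linarith
    have r1' : r < 1 := by exact_mod_cast r1
    have r2' : -1 < r := by exact_mod_cast r2
    omega
  · obtain rfl : j = 30 := by
      by_contra hne
      have := I.lift_lt (h2.trans_le (b4 (by omega)))
      push_cast at this
      linarith
    have hA : nA (I.delay k) 30 = 2 := by simp only [nA]; split_ifs <;> omega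
    have hB : nB (I.delay k) 30 = 28 := by rw [nB, hA]
    rw [nextTime, if_neg (by norm_num)] at h2
    rw [hA] at hY y1 y2
    norm_num [fold] at hY y1 y2
    -- After this crossing the local abscissa `14 - (t - 406)` lies strictly between `6 - delay` and
    -- `7 - delay`.
    have ht : I.cross k 3 ≤ t := by
      by_contra hlt
      have := I.lift_lt (not_le.1 hlt)
      norm_num at this
      linarith
    have hc := (I.cross_mem k 3 (by norm_num) (by norm_num)).1
    norm_num at hc
    have hY' : I.lift k t < 4 := by
      have e1 := I.lift_end k
      have e2 : I.lift k t < I.lift k (414 + I.delay k) := by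
        simp only [lift]
        exact mul_lt_mul_of_pos_left (by linarith) I.S_pos
      have e3 : I.lift (k + 1) 0 < 1 := by
        have := I.phase_pos (k + 1)
        have := I.phase_lt (k + 1)
        have := I.S_lt_one
        have := I.S_pos
        simp only [lift]; nlinarith
      linarith
    have r1 : (r : ℝ) < 2 := by linarith
    have r2 : (-1 : ℝ) < r := by linarith
    have r1' : r < 2 := by exact_mod_cast r1
    have r2' : -1 < r := by exact_mod_cast r2
    obtain rfl : r = 1 := by omega
    rw [hB, zig, (turn_two_mul 14).1] at x1 x2
    norm_num [tri] at x1 x2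
    have d1 : (c : ℝ) < 7 - I.delay k := by linarith
    have d2 : (5 - I.delay k : ℝ) < c := by linarith
    have d1' : c < 7 - I.delay k := by exact_mod_cast d1
    have d2' : (5 - I.delay k : ℤ) < c := by exact_mod_cast d2
    obtain rfl : c = 6 - I.delay k := by omega
    refine hC.2 (31 * k + 17) (by omega) ?_
    rw [I.brick_block (by norm_num), localBrick, if_pos rfl]

/-- An integer ordinate forces `t` to be a crossing and an integer abscissa forces `t` to be an
integer; crossings lie strictly between consecutive integers. -/
theorem avoids_lattice (k j : ℕ) (hj : j < 31) {t : ℝ} (h1 : I.hitTime k j ≤ t)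
    (h2 : t ≤ I.nextTime k j) (C : ℤ × ℤ) :
    I.seg k j (I.start k + t) ≠ ((C.1 : ℝ), (C.2 : ℝ)) := by
  intro h
  rw [seg, add_sub_cancel_left, embed, Prod.mk.injEq] at h
  obtain ⟨hx, hy⟩ := h
  dsimp only at hx hy
  obtain ⟨-, b1, -, -, b4, -⟩ := I.segment_bounds k j hj
  have hS := I.S_pos
  have ht0 : 0 ≤ t := le_trans (Nat.cast_nonneg _) (b1.trans h1)
  have p1 := I.phase_lt k
  have hpos : 0 < I.lift k t := mul_pos hS (by linarith)
  have hlt : I.lift k t < 4 := by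
    by_cases h30 : j < 30
    · have h3 := h2.trans (b4 h30)
      have h4 := I.lift_sub k (nA (I.delay k) j + 1) t
      have h5 := mul_nonneg hS.le (sub_nonneg.2 h3)
      have h6 : ((nA (I.delay k) j : ℕ) : ℝ) ≤ 2 := by exact_mod_cast nA_le _ _
      push_cast at h4
      linarith
    · rw [nextTime, if_neg h30] at h2
      have e1 := I.lift_end k
      have e2 : I.lift k t ≤ I.lift k (414 + I.delay k) := by
        simp only [lift]
        exact mul_le_mul_of_nonneg_left (by linarith) hS.le
      have e3 : I.lift (k + 1) 0 < 1 := by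
        have := I.phase_pos (k + 1)
        have := I.phase_lt (k + 1)
        have := I.S_lt_one
        simp only [lift]; nlinarith
      linarith
  obtain ⟨l, hl⟩ : ∃ l : ℤ, I.lift k t = l := by
    rw [fold] at hy
    rcases neg_one_pow_eq_or ℝ (nA (I.delay k) j) with hs | hs <;> rw [hs] at hy
    · exact ⟨C.2 - k + nA (I.delay k) j - ((nA (I.delay k) j % 2 : ℕ) : ℤ), by
        rw [Int.cast_sub, Int.cast_natCast]; push_cast; linarith⟩
    · exact ⟨-(C.2 - k) + nA (I.delay k) j + ((nA (I.delay k) j % 2 : ℕ) : ℤ), by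
        rw [Int.cast_add, Int.cast_natCast]; push_cast; linarith⟩
  rw [hl] at hpos hlt
  have l1 : 0 < l := by exact_mod_cast hpos
  have l2 : l < 4 := by exact_mod_cast hlt
  lift l to ℕ using l1.le
  have hcr := I.lift_sub k l t
  rw [hl] at hcr
  have hteq : t = I.cross k l := by
    rcases mul_eq_zero.1 (show I.S * (t - I.cross k l) = 0 by push_cast at hcr; linarith) with h | h
    · exact absurd h hS.ne'
    · linarith
  have hc := I.cross_mem k l (by omega) (by omega)
  obtain ⟨z, hz⟩ : ∃ z : ℤ, t = z := by
    rw [zig] at hx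
    rcases neg_one_pow_eq_or ℝ k with hs | hs <;> rw [hs] at hx <;>
    rcases neg_one_pow_eq_or ℝ (nB (I.delay k) j) with hs' | hs' <;> rw [hs'] at hx
    · exact ⟨I.center k - C.1 + turn (nB (I.delay k) j) + tri (nB (I.delay k) j), by
        push_cast; linarith⟩
    · exact ⟨-(I.center k - C.1 + turn (nB (I.delay k) j)) + tri (nB (I.delay k) j), by
        push_cast; linarith⟩
    · exact ⟨-(I.center k - C.1) + turn (nB (I.delay k) j) + tri (nB (I.delay k) j), by
        push_cast; linarith⟩
    · exact ⟨I.center k - C.1 - turn (nB (I.delay k) j) + tri (nB (I.delay k) j), by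
        push_cast; linarith⟩
  rw [← hteq, hz] at hc
  have q1 : 138 * (l : ℤ) - 1 + I.delay k < z := by exact_mod_cast hc.1
  have q2 : z < 138 * (l : ℤ) + I.delay k := by exact_mod_cast hc.2
  omega

end Itinerary
end Breakout
namespace Breakout

/-! ### Gluing the segments into an orbit -/

/-- Continuous segments can be glued to a path. -/
theorem exists_path {time : ℕ → ℝ} (h : StrictMono time) (seg : ℕ → ℝ → ℝ × ℝ)
    (hs : ∀ n, seg n (time (n + 1)) = seg (n + 1) (time (n + 1))) :
    ∃ path : ℝ → ℝ × ℝ, ∀ n, ∀ t ∈ Set.Icc (time n) (time (n + 1)), path t = seg n t := by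
  classical
  have key : ∀ n m t, n < m → t ∈ Set.Icc (time n) (time (n + 1)) →
      t ∈ Set.Icc (time m) (time (m + 1)) → seg n t = seg m t := by
    intro n m t hnm hn hm
    have h1 : time m ≤ time (n + 1) := hm.1.trans hn.2
    -- Two different time intervals can only share a common endpoint, where the segments agree by
    -- `hs`.
    obtain rfl : m = n + 1 := le_antisymm (h.le_iff_le.1 h1) hnm
    obtain rfl : t = time (n + 1) := le_antisymm hn.2 hm.1
    exact hs n
  refine ⟨fun t => if h : ∃ n, t ∈ Set.Icc (time n) (time (n + 1)) then seg h.choose t else 0,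
    fun n t ht => ?_⟩
  have hex : ∃ n, t ∈ Set.Icc (time n) (time (n + 1)) := ⟨n, ht⟩
  beta_reduce
  rw [dif_pos hex]
  rcases lt_trichotomy hex.choose n with h' | h' | h'
  · exact key _ _ _ h' hex.choose_spec ht
  · rw [h']
  · exact (key _ _ _ h' ht hex.choose_spec).symm

namespace Itinerary

variable (I : Itinerary)

theorem seg_glue (n : ℕ) :
    I.seg (n / 31) (n % 31) (I.time (n + 1)) =
      I.seg ((n + 1) / 31) ((n + 1) % 31) (I.time (n + 1)) := by
  obtain ⟨k, j, hj, rfl⟩ := exists_block n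
  rw [add_div_31 hj, add_mod_31 hj, I.time_next hj]
  by_cases h : j < 30
  · rw [add_assoc, add_div_31 (by omega), add_mod_31 (by omega)]
    exact I.seg_step k j h _ rfl
  · obtain rfl : j = 30 := by omega
    rw [show (31 * k + 30 + 1) / 31 = k + 1 by omega, show (31 * k + 30 + 1) % 31 = 0 by omega]
    exact I.seg_end k

/-- The path of the ball. -/
noncomputable def path : ℝ → ℝ × ℝ := (exists_path I.time_strictMono _ I.seg_glue).choose

theorem path_eq_seg {k j : ℕ} (hj : j < 31) {t : ℝ} (h1 : I.hitTime k j ≤ t)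
    (h2 : t ≤ I.nextTime k j) : I.path (I.start k + t) = I.seg k j (I.start k + t) := by
  have h := (exists_path I.time_strictMono _ I.seg_glue).choose_spec (31 * k + j)
    (I.start k + t)
  rw [add_div_31 hj, add_mod_31 hj, I.time_block hj, I.time_next hj] at h
  exact h ⟨by linarith, by linarith⟩

/-- Every time lies in a segment. -/
theorem exists_segment {t : ℝ} (ht : 0 ≤ t) : ∃ k j s, j < 31 ∧ I.hitTime k j ≤ s ∧
    s ≤ I.nextTime k j ∧ t = I.start k + s := by
  classical
  have hex : ∃ n, t < I.time n := (I.time_tendsto.eventually_gt_atTop t).exists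
  have hspec := Nat.find_spec hex
  have hpos : Nat.find hex ≠ 0 := by
    intro h
    rw [h, I.time_zero] at hspec
    linarith
  obtain ⟨n, hn⟩ := Nat.exists_eq_succ_of_ne_zero hpos
  have hmin := Nat.find_min hex (m := n) (by omega)
  rw [hn, Nat.succ_eq_add_one] at hspec
  obtain ⟨k, j, hj, rfl⟩ := exists_block n
  rw [I.time_next hj] at hspec
  rw [I.time_block hj, not_lt] at hmin
  exact ⟨k, j, t - I.start k, hj, by linarith, by linarith, by ring⟩

/-- The breakout orbit of an itinerary. -/
noncomputable def orbit : BreakoutOrbit I.S (I.S * (1 - I.phase 0)) where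
  path := I.path
  time := I.time
  vel := I.vel
  brick := I.brick
  word := I.word
  slope_mem := ⟨I.S_pos, I.S_lt_one⟩
  ordinate_mem := by
    have h1 := I.S_pos
    have h2 := I.S_lt_one
    have h3 := I.phase_pos 0
    have h4 := I.phase_lt 0
    exact ⟨mul_pos h1 (by linarith), by nlinarith⟩
  path_zero := by
    have h1 := I.hitTime_zero 0
    have h2 := (I.segment_bounds 0 0 (by norm_num)).1
    have h := I.path_eq_seg (k := 0) (j := 0) (t := 0) (by norm_num) h1.le (h1 ▸ h2.le)
    simpa [start, center, seg, embed, nA, nB, zig, turn, tri, fold, lift] using h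
  vel_zero := I.vel_zero
  time_zero := I.time_zero
  time_strictMono := I.time_strictMono
  time_tendsto := I.time_tendsto
  vel_succ := I.vel_succ
  path_eq := by
    intro n t ht
    obtain ⟨k, j, hj, rfl⟩ := exists_block n
    rw [I.time_block hj, I.time_next hj] at ht
    have h := (I.segment_bounds k j hj).1
    rw [I.time_block hj, I.vel_succ_block hj, I.path_eq_seg hj le_rfl h.le, ← I.seg_eq]
    have := I.path_eq_seg hj (t := t - I.start k) (by linarith [ht.1]) (by linarith [ht.2])
    rwa [add_sub_cancel] at this
  brick_mem := I.brick_mem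
  hits := by
    intro n
    obtain ⟨k, j, hj, rfl⟩ := exists_block n
    rw [I.time_block hj, I.path_eq_seg hj le_rfl (I.segment_bounds k j hj).1.le]
    exact I.hits k j hj
  free := by
    intro n t ht C hC
    obtain ⟨k, j, hj, rfl⟩ := exists_block n
    rw [I.time_block hj, I.time_next hj] at ht
    have h1 : I.hitTime k j < t - I.start k := by linarith [ht.1]
    have h2 : t - I.start k < I.nextTime k j := by linarith [ht.2]
    have h := I.free k j hj h1 h2 C hC
    rw [← I.path_eq_seg hj h1.le h2.le, add_sub_cancel] at h
    exact h
  avoids_lattice := by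
    intro t ht C
    obtain ⟨k, j, s, hj, h1, h2, rfl⟩ := I.exists_segment ht
    rw [I.path_eq_seg hj h1 h2]
    exact I.avoids_lattice k j hj h1 h2 C

/-! ### Blocks of an itinerary -/

/-- Each block adds three units to the unfolded ordinate, although the ball rises by only one row.
-/
theorem lift_add_start (k : ℕ) (x : ℝ) :
    I.S * (1 - I.phase 0) + I.S * (I.start k + x) = 3 * k + I.lift k x := by
  induction k generalizing x with
  | zero => simp [start, lift]; ring
  | succ k ih =>
    have h1 := ih (414 + I.delay k + x)
    have h2 := I.slope_eq
    rw [start_succ]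
    simp only [lift, I.phase_succ] at h1 ⊢
    push_cast
    linear_combination h1 + 3 * h2

theorem abscissa {k j : ℕ} (hj : j < 31) {t : ℕ} (h1 : I.hitTime k j ≤ t)
    (h2 : t ≤ I.nextTime k j) :
    I.orbit.travelAbscissa (I.start k + t) = I.center k + (-1) ^ k * zig (nB (I.delay k) j) t := by
  have h := I.path_eq_seg hj h1 h2
  rw [BreakoutOrbit.travelAbscissa]
  push_cast
  change (I.path _).1 = _
  rw [h, seg, embed, add_sub_cancel_left]

theorem abscissa_start (k : ℕ) : I.orbit.travelAbscissa (I.start k) = I.center k := by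
  have h1 := I.hitTime_zero k
  have h2 := (I.segment_bounds k 0 (by norm_num)).1
  rw [h1] at h2
  have h := I.abscissa (k := k) (j := 0) (t := 0) (by norm_num) (by simp [h1])
    (by simpa using h2.le)
  simpa [nB, zig, turn, tri] using h

/-- `Δ` is the sequence of blocks of the itinerary. -/
def HasBlocks (Δ : ℕ → Block) : Prop :=
  ∀ k, Δ k = if I.delay k = 1 then blockL0 else blockL

variable {I} {Δ : ℕ → Block}

theorem HasBlocks.len (h : I.HasBlocks Δ) (k : ℕ) (i : Fin 3) :
    (Δ k).len i = 138 * (i + 1) + I.delay k := by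
  rw [h k]
  rcases I.delay_cases k with hd | hd <;> rw [hd] <;> fin_cases i <;> rfl

theorem HasBlocks.totalLen (h : I.HasBlocks Δ) (N : ℕ) : totalLen Δ N = I.start N :=
  Finset.sum_congr rfl fun k _ => h.len k 2

theorem HasBlocks.reversals (h : I.HasBlocks Δ) (N : ℕ) : reversals Δ N = N * 29 := by
  rw [Breakout.reversals, Finset.sum_congr rfl (g := fun _ => 29), Finset.sum_const,
    Finset.card_range, smul_eq_mul]
  intro k _
  rw [h k]
  split_ifs <;> rfl

/-- A unit of distance raises the ordinate by `S`, so this says that the crossing falls in the last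
unit of distance, which is `cross_mem`. -/
theorem HasBlocks.lift_mem (h : I.HasBlocks Δ) (k : ℕ) (i : Fin 3) :
    I.lift k ((Δ k).len i) ∈ Set.Ioo ((i : ℝ) + 1) ((i : ℝ) + 1 + I.S) := by
  have hc := I.cross_mem k (i + 1) (by omega) (by omega)
  rw [h.len k i]
  push_cast at hc ⊢
  constructor
  · have := I.lt_lift hc.2
    push_cast at this
    exact this
  · have := I.lift_lt (k := k) (t := 138 * ((i : ℝ) + 1) + I.delay k - 1) (m := i + 1)
      (by linarith)
    push_cast at this
    simp only [lift] at this ⊢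
    linarith

theorem HasBlocks.isElementary (h : I.HasBlocks Δ) (k : ℕ) : (Δ k).IsElementary := by
  have h1 := I.S_pos
  have h2 := I.phase_pos k
  have h3 := I.phase_lt k
  refine ⟨⟨?_, I.S, ⟨h1, I.S_lt_one⟩, I.S * (1 - I.phase k),
    ⟨mul_pos h1 (by linarith), by nlinarith⟩, fun i => ?_⟩, ?_⟩
  · rw [h k]; split_ifs <;> decide
  · have := h.lift_mem k i
    rwa [show travelOrdinate I.S (I.S * (1 - I.phase k)) ((Δ k).len i) = I.lift k ((Δ k).len i) by
      rw [travelOrdinate, lift]; ring]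
  · rw [h k]; split_ifs <;> decide

/-- A block has 29 reversals, an odd number, so the required sign is the orientation `(-1) ^ N` of
block `N`. The distances for `i = 0, 1` lie in the segments that follow the two horizontal hits; for
`i = 2` the next block starts. -/
theorem HasBlocks.hasElementarySequence (h : I.HasBlocks Δ) :
    I.orbit.HasElementarySequence Δ := by
  refine ⟨h.isElementary, fun N i => ?_⟩
  have hc1 := I.cross_mem N 1 (by norm_num) (by norm_num)
  have hc2 := I.cross_mem N 2 (by norm_num) (by norm_num)
  rw [h.totalLen, h.reversals, abscissa_start, mul_comm N, pow_mul, h.len N i,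
    show (-1 : ℝ) ^ 29 = -1 by norm_num]
  by_cases h2 : i = 2
  · subst h2
    rw [show 138 * (((2 : Fin 3) : ℕ) + 1) + I.delay N = 414 + I.delay N from rfl, ← start_succ,
      abscissa_start, center_succ, h N]
    push_cast
    rcases I.delay_cases N with hd | hd <;> rw [hd]
    · rw [if_neg (by norm_num), show blockL.X 2 = 6 by decide]; norm_num
    · rw [if_pos rfl, show blockL0.X 2 = 5 by decide]; norm_num
  rcases I.delay_cases N with hd | hd
  all_goals
    have hN := h N
    rw [hd] at hc1 hc2 hN ⊢
    norm_num at hc1 hc2 hN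
    rw [hN]
    fin_cases i
  · rw [I.abscissa (j := 17) (by norm_num), hd, show blockL.X _ = 6 from by decide,
      show nB 0 17 = 2 * 8 from rfl, zig, (turn_two_mul 8).1]
    · norm_num [tri]
    · norm_num [hitTime]; linarith
    · norm_num [nextTime, hitTime, hd, nB, nA, tri]
  · rw [I.abscissa (j := 24) (by norm_num), hd, show blockL.X _ = -12 from by decide,
      show nB 0 24 = 2 * 11 from rfl, zig, (turn_two_mul 11).1]
    · norm_num [tri]
    · norm_num [hitTime, hd]; linarith
    · norm_num [nextTime, hitTime, hd, nB, nA, tri]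
  · exact absurd rfl h2
  · rw [I.abscissa (j := 17) (by norm_num), hd, show blockL0.X _ = 5 from by decide,
      show nB 1 17 = 2 * 8 from rfl, zig, (turn_two_mul 8).1]
    · norm_num [tri]
    · norm_num [hitTime]; linarith
    · norm_num [nextTime, hitTime, hd, nB, nA, tri]
  · rw [I.abscissa (j := 25) (by norm_num), hd, show blockL0.X _ = -11 from by decide,
      show nB 1 25 = 2 * 11 + 1 from rfl, zig, (turn_two_mul 11).2]
    · norm_num [tri]
    · norm_num [hitTime, hd]; linarith
    · norm_num [nextTime, hitTime, hd, nB, nA, tri]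
  · exact absurd rfl h2

theorem concatSlices_block (k : ℕ) :
    concatSlices Δ (3 * k) = (Δ k).len 0 ∧
      concatSlices Δ (3 * k + 1) = (Δ k).len 1 - (Δ k).len 0 ∧
      concatSlices Δ (3 * k + 2) = (Δ k).len 2 - (Δ k).len 1 := by
  have h0 : Fin.ofNat 3 (3 * k) = 0 := by ext; simp
  have h1 : Fin.ofNat 3 (3 * k + 1) = 1 := by ext; simp
  have h2 : Fin.ofNat 3 (3 * k + 2) = 2 := by ext; simp
  rw [concatSlices, concatSlices, concatSlices, h0, h1, h2, show 3 * k / 3 = k by omega,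
    show (3 * k + 1) / 3 = k by omega, show (3 * k + 2) / 3 = k by omega]
  exact ⟨rfl, rfl, rfl⟩

theorem sum_concatSlices (k : ℕ) :
    ∑ n ∈ Finset.range (3 * k), concatSlices Δ n = totalLen Δ k := by
  induction k with
  | zero => simp [Breakout.totalLen]
  | succ k ih =>
    obtain ⟨h0, h1, h2⟩ := concatSlices_block (Δ := Δ) k
    rw [show 3 * (k + 1) = 3 * k + 1 + 1 + 1 by ring, Finset.sum_range_succ,
      Finset.sum_range_succ, Finset.sum_range_succ, ih, h0, h1, h2, Breakout.totalLen,
      Breakout.totalLen, Finset.sum_range_succ]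
    push_cast; ring

theorem sum_concatSlices_add (k : ℕ) (i : Fin 3) :
    ∑ n ∈ Finset.range (3 * k + i + 1), concatSlices Δ n = totalLen Δ k + (Δ k).len i := by
  obtain ⟨h0, h1, h2⟩ := concatSlices_block (Δ := Δ) k
  fin_cases i
  · change ∑ n ∈ Finset.range (3 * k + 1), concatSlices Δ n = totalLen Δ k + (Δ k).len 0
    rw [Finset.sum_range_succ, sum_concatSlices, h0]
  · change ∑ n ∈ Finset.range (3 * k + 1 + 1), concatSlices Δ n = totalLen Δ k + (Δ k).len 1
    rw [Finset.sum_range_succ, Finset.sum_range_succ, sum_concatSlices, h0, h1]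
    ring
  · change ∑ n ∈ Finset.range (3 * k + 1 + 1 + 1), concatSlices Δ n = totalLen Δ k + (Δ k).len 2
    rw [Finset.sum_range_succ, Finset.sum_range_succ, Finset.sum_range_succ, sum_concatSlices, h0,
      h1, h2]
    ring

theorem HasBlocks.isSlicingSequence (h : I.HasBlocks Δ) :
    IsSlicingSequence I.S (I.S * (1 - I.phase 0)) (concatSlices Δ) := by
  intro N
  obtain ⟨k, i, rfl⟩ : ∃ (k : ℕ) (i : Fin 3), N = 3 * k + i :=
    ⟨N / 3, ⟨N % 3, by omega⟩, by simp only; omega⟩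
  have h1 := h.lift_mem k i
  have h2 : (∑ n ∈ Finset.range (3 * k + i + 1), (concatSlices Δ n : ℝ)) =
      I.start k + (Δ k).len i := by
    have := sum_concatSlices_add (Δ := Δ) k i
    rw [h.totalLen] at this
    exact_mod_cast this
  rw [travelOrdinate, h2, I.lift_add_start]
  push_cast
  exact ⟨by linarith [h1.1], by linarith [h1.2]⟩

end Itinerary

/-! ### The periodic itineraries -/

/-- The excess of the length of the `k`-th block of `(Λ^(J-1) Λ₀₊)^∞` over `414`. -/
def bump (J k : ℕ) : ℕ := if k % J + 1 = J then 1 else 0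

theorem mod_succ_eq {J : ℕ} (hJ : 0 < J) (k : ℕ) :
    (k + 1) % J = if k % J + 1 = J then 0 else k % J + 1 := by
  have h := Nat.mod_lt k hJ
  rw [Nat.add_mod]
  split_ifs with h'
  · rcases Nat.lt_or_ge 1 J with h1 | h1
    · rw [Nat.mod_eq_of_lt h1, h', Nat.mod_self]
    · obtain rfl : J = 1 := by omega
      simp [Nat.mod_one]
  · rw [Nat.mod_eq_of_lt (show 1 < J by omega), Nat.mod_eq_of_lt (by omega)]

/-- The itinerary through the blocks `(Λ^(J-1) Λ₀₊)^∞`. -/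
noncomputable def itinerary (J : ℕ) (hJ : 0 < J) : Itinerary where
  S := slope J
  ε := 1 / (6 * J)
  delay := bump J
  -- With `c` in place of `5`, `phase_lt` at the last block of a period requires `c < 6` and
  -- `lt_phase` there requires `4 < c`; `5` is the midpoint.
  phase k := (6 * (k % J : ℕ) + 5) / (6 * J)
  ε_pos := by positivity
  slope_eq := by
    rw [slope]; field_simp; ring
  delay_le k := by rw [bump]; split_ifs <;> omega
  phase_pos k := by positivity
  phase_lt k := by
    have h := Nat.mod_lt k hJ
    have h' : ((k % J : ℕ) : ℝ) + 1 ≤ J := by exact_mod_cast h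
    rw [div_lt_one (by positivity)]
    linarith
  lt_phase k := by
    have hJ' : (0 : ℝ) < J := by exact_mod_cast hJ
    rw [mul_one_div, ← add_div, lt_div_iff₀ (by positivity), bump]
    split_ifs with h
    · have h' : ((k % J : ℕ) : ℝ) + 1 = J := by exact_mod_cast h
      push_cast; linarith
    · push_cast; linarith [Nat.cast_nonneg (α := ℝ) (k % J)]
  phase_add_lt k := by
    have hJ' : (0 : ℝ) < J := by exact_mod_cast hJ
    rw [mul_one_div, ← add_div, div_lt_iff₀ (by positivity), bump]
    have h := Nat.mod_lt k hJ
    split_ifs with h1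
    · have h' : ((k % J : ℕ) : ℝ) + 1 = J := by exact_mod_cast h1
      have h2 : (1 : ℝ) ≤ J := by exact_mod_cast hJ
      push_cast; linarith
    · have h' : ((k % J : ℕ) : ℝ) + 2 ≤ J := by
        exact_mod_cast (show k % J + 2 ≤ J by omega)
      push_cast; linarith
  phase_succ k := by
    have hJ' : (0 : ℝ) < J := by exact_mod_cast hJ
    rw [mod_succ_eq hJ, bump]
    split_ifs with h1
    · have h' : ((k % J : ℕ) : ℝ) = J - 1 := by
        have : ((k % J : ℕ) : ℝ) + 1 = J := by exact_mod_cast h1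
        linarith
      rw [h']; push_cast; field_simp; ring
    · push_cast; field_simp; ring

theorem itinerary_hasBlocks (J : ℕ) (hJ : 0 < J) : (itinerary J hJ).HasBlocks (blockSeq J) := by
  intro k
  simp only [itinerary, blockSeq, bump]
  split_ifs <;> simp_all

/-! ### Periods of the symbolic words -/

/-- The symbolic orbit of the itinerary through `(Λ^(J-1) Λ₀₊)^∞`. -/
def periodicWord (J n : ℕ) : Letter := letter (bump J (n / 31)) (n % 31)

theorem bump_le (J k : ℕ) : bump J k ≤ 1 := by rw [bump]; split_ifs <;> omega

theorem periodicWord_block {J k j : ℕ} (hj : j < 31) :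
    periodicWord J (31 * k + j) = letter (bump J k) j := by
  rw [periodicWord, add_div_31 hj, add_mod_31 hj]

theorem isPeriod_periodicWord {J : ℕ} (hJ : 0 < J) : IsPeriod (periodicWord J) (31 * J) := by
  refine ⟨by omega, fun n => ?_⟩
  rw [periodicWord, periodicWord, bump, bump, Nat.add_mul_div_left _ _ (by norm_num),
    Nat.add_mul_mod_self_left, Nat.add_mod_right]

/-- Letters `a` occur only at positions `17` and `24` or `25` of the 31-letter blocks. Shifting the
two letters `a` of the first block forces `31 ∣ p`, and then `p / 31` shifts the delays onto
themselves. -/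
theorem le_of_isPeriod {J p : ℕ} (hJ : 1 < J) (hp : IsPeriod (periodicWord J) p) : J ≤ p := by
  obtain ⟨hp0, hp⟩ := hp
  have b0 : bump J 0 = 0 := by
    rw [bump, if_neg]; rw [Nat.zero_mod]; omega
  obtain ⟨q, r, hr, rfl⟩ := exists_block p
  have h17 := hp (31 * 0 + 17)
  have h24 := hp (31 * 0 + 24)
  rw [periodicWord_block (by norm_num), b0] at h17 h24
  have hr' : r = 0 ∨ r = 7 ∨ r = 8 := by
    by_contra hne
    rcases lt_or_ge (17 + r) 31 with h | h
    · rw [show 31 * 0 + 17 + (31 * q + r) = 31 * q + (17 + r) by ring, periodicWord_block h] at h17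
      have := bump_le J q
      simp only [letter] at h17
      rw [if_neg (by omega)] at h17
      simp at h17
    · rw [show 31 * 0 + 17 + (31 * q + r) = 31 * (q + 1) + (r - 14) by omega,
        periodicWord_block (by omega)] at h17
      have := bump_le J (q + 1)
      simp only [letter] at h17
      by_cases h' : r - 14 = 17 ∨ r - 14 = 24 + bump J (q + 1)
      · omega
      · rw [if_neg h'] at h17
        simp at h17
  rcases hr' with rfl | rfl | rfl
  · have h1 : J - 1 < J := by omega
    have b1 : bump J (J - 1) = 1 := by
      rw [bump, if_pos]; rw [Nat.mod_eq_of_lt h1]; omega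
    have h := hp (31 * (J - 1) + 24)
    rw [show 31 * (J - 1) + 24 + (31 * q + 0) = 31 * (J - 1 + q) + 24 by ring,
      periodicWord_block (by norm_num), periodicWord_block (by norm_num), b1] at h
    by_contra hlt
    have hq : q < J := by omega
    have b2 : bump J (J - 1 + q) = 0 := by
      have e : (J - 1 + q) % J = q - 1 := by
        rw [show J - 1 + q = q - 1 + J by omega, Nat.add_mod_right, Nat.mod_eq_of_lt (by omega)]
      rw [bump, if_neg]; rw [e]; omega
    rw [b2] at h
    simp [letter] at h
  · rw [show 31 * 0 + 24 + (31 * q + 7) = 31 * (q + 1) + 0 by ring,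
      periodicWord_block (by norm_num)] at h24
    have h0 : 0 ≠ 24 + bump J (q + 1) := by omega
    simp [letter, h0] at h24
  · rw [show 31 * 0 + 24 + (31 * q + 8) = 31 * (q + 1) + 1 by ring,
      periodicWord_block (by norm_num)] at h24
    have h0 : 1 ≠ 24 + bump J (q + 1) := by omega
    simp [letter, h0] at h24

/-- The words differ in block `J - 1`, which is delayed for `J` but not yet for `J'`. -/
theorem periodicWord_ne {J J' : ℕ} (hJ : 1 < J) (h : J < J') :
    periodicWord J ≠ periodicWord J' := by
  intro heq
  have h1 := congrFun heq (31 * (J - 1) + 24)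
  rw [periodicWord_block (by norm_num), periodicWord_block (by norm_num), bump, bump,
    Nat.mod_eq_of_lt (by omega), Nat.mod_eq_of_lt (by omega), if_pos (by omega),
    if_neg (by omega)] at h1
  simp [letter] at h1

theorem periodicWord_injective {J J' : ℕ} (hJ : 1 < J) (hJ' : 1 < J') (h : J ≠ J') :
    periodicWord J ≠ periodicWord J' := by
  rcases lt_or_gt_of_ne h with h | h
  · exact periodicWord_ne hJ h
  · exact (periodicWord_ne hJ' h).symm

end Breakout

theorem mainTheorem7 :
    {ω : ℕ → Breakout.Letter | Breakout.IsSymbolicOrbit ω ∧ Breakout.IsPeriodicWord ω}.Infinite ∧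
    ∃ ω : ℕ → ℕ → Breakout.Letter,
      (∀ J : ℕ, 1 < J →
        Breakout.IsPeriodicWord (ω J) ∧
        ∃ y ∈ Set.Ioo (0 : ℝ) (Breakout.slope J),
          ∃ o : Breakout.BreakoutOrbit (Breakout.slope J) y,
            o.HasElementarySequence (Breakout.blockSeq J) ∧
            Breakout.IsSlicingSequence (Breakout.slope J) y
              (Breakout.concatSlices (Breakout.blockSeq J)) ∧
            o.word = ω J) ∧
      (∀ J J' : ℕ, 1 < J → 1 < J' → J ≠ J' → ω J ≠ ω J') ∧
      (∀ N : ℕ, ∃ J : ℕ, 1 < J ∧ ∀ p : ℕ, Breakout.IsPeriod (ω J) p → N ≤ p) := by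
  refine ⟨?_, Breakout.periodicWord, fun J hJ => ?_, fun J J' hJ hJ' h => ?_, fun N => ?_⟩
  · refine Set.infinite_of_injective_forall_mem (f := fun n => Breakout.periodicWord (n + 2))
      (fun m n h => ?_) fun n => ⟨⟨_, _, (Breakout.itinerary (n + 2) (by omega)).orbit, rfl⟩,
        _, Breakout.isPeriod_periodicWord (by omega)⟩
    by_contra hne
    exact Breakout.periodicWord_injective (by omega) (by omega) (by omega) h
  · have hJ0 : 0 < J := by omega
    have hb := Breakout.itinerary_hasBlocks J hJ0
    have h1 := (Breakout.itinerary J hJ0).S_pos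
    have h2 := (Breakout.itinerary J hJ0).phase_pos 0
    have h3 := (Breakout.itinerary J hJ0).phase_lt 0
    exact ⟨⟨_, Breakout.isPeriod_periodicWord hJ0⟩, _,
      ⟨mul_pos h1 (sub_pos.2 h3), mul_lt_of_lt_one_right h1 (by linarith)⟩,
      (Breakout.itinerary J hJ0).orbit, hb.hasElementarySequence, hb.isSlicingSequence, rfl⟩
  · exact Breakout.periodicWord_injective hJ hJ' h
  · exact ⟨N + 2, by omega, fun p hp =>
      (Nat.le_add_right N 2).trans (Breakout.le_of_isPeriod (by omega) hp)⟩
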